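/- A (finite soft) excursion $\varepsilon$ of length $2n$, $n\ge 0$, is a sequence $\varepsilon(0),\dots,\varepsilon(2n)$ of nonnegative integers with $\varepsilon(0)=\varepsilon(2n)=0$ and $|\varepsilon(i)-\varepsilon(i-1)|=1$ for $1\le i\le 2n$. Its ball configuration $\eta\in\{0,1\}^{\mathbb Z}$ is given by $\eta(i)=1$ if $1\le i\le 2n$ and $\varepsilon(i)-\varepsilon(i-1)=1$, and $\eta(i)=0$ otherwise. The elements of $\mathbb Z$ are called boxes; a box $i$ is occupied if $\eta(i)=1$ and empty if $\eta(i)=0$. A soliton is a pair consisting of a set of occupied boxes (its head) and a set of empty boxes (its tail). *Head–Tail decomposition.* Starting from $\eta$, repeat the following. A run is a maximal set of consecutive boxes with equal content, where boxes of solitons already identified are ignored and the remaining boxes are glued together; its size is its number of boxes, possibly infinite. If there is just one single infinite run, stop. Otherwise take the leftmost among the smallest runs. If it is occupied, pair its boxes with the same number of nearest remaining boxes to its right, which are empty; if it is empty, pair its boxes with the same number of nearest remaining boxes to its left, which are occupied. The paired occupied and empty boxes are the head and the tail of a new soliton. The set of all solitons identified when the algorithm stops is the Head–Tail soliton decomposition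 of $\varepsilon$. *Tree decomposition.* The planar rooted tree of $\varepsilon$ has a root, corresponding to the region below height $0$, and one node for every connected component of the regions into which the horizontal lines at integer heights cut the part between height $0$ and the graph of $\varepsilon$. Such a component between heights $h-1$ and $h$ is bounded on the left by an up-step (box $a$) from $h-1$ to $h$ and on the right by the first later down-step (box $b$) from $h$ to $h-1$. A node is an offspring of the node directly below it with which it shares a piece of horizontal line, and the offspring of a node are ordered from left to right. Each leaf (non-root node without offspring) gets generation number $1$ and a color of its own. Recursively, a non-root node all of whose offspring are numbered and colored gets the color of the rightmost among its offspring with the largest generation number $g$, and generation number $g+1$. The branches are the color classes. The soliton* of a branch has as head the boxes $a$ and as tail the boxes $b$ of its nodes. The set of the solitons* of all branches is the tree decomposition of $\varepsilon$. **Proposition.** For every excursion $\varepsilon$, the Head–Tail algorithm can be carried out and stops after finitely many steps, and the Head–Tail soliton decomposition of $\varepsilon$ coincides with the tree decomposition of $\varepsilon$: both consist of the same solitons, with the same heads and the same tails. -/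

import Mathlib

namespace BoxBall

/-- A finite soft excursion: a nearest-neighbour walk `walk 0, …, walk (2 n)` that is nonnegative and
starts and ends at `0`.  The values outside `[0, 2 n]` carry no information; they are normalised
to `0`, so that excursions are equal exactly when their walks are. -/
structure SoftExcursion where
  n : ℕ
  walk : ℤ → ℤ
  walk_zero : walk 0 = 0
  walk_end : walk (2 * n) = 0
  walk_step : ∀ i : ℤ, 0 < i → i ≤ 2 * n → |walk i - walk (i - 1)| = 1
  walk_nonneg : ∀ i : ℤ, 0 ≤ i → i ≤ 2 * n → 0 ≤ walk i
  walk_outside : ∀ i : ℤ, i < 0 ∨ 2 * n < i → walk i = 0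

/-- A ball configuration on `ℤ`: `true` is an occupied box, `false` an empty box. -/
abbrev BallConfiguration := ℤ → Bool

/-- The ball configuration of an excursion: box `i` with `1 ≤ i ≤ 2 n` is occupied when the `i`-th step
goes up and empty when it goes down; all the other boxes are empty. -/
def SoftExcursion.balls (ε : SoftExcursion) : BallConfiguration := fun i =>
  decide (0 < i ∧ i ≤ 2 * (ε.n : ℤ) ∧ ε.walk i - ε.walk (i - 1) = 1)

/-- A soliton, given by its head (occupied boxes) and its tail (empty boxes). -/
@[ext]
structure Soliton where
  head : Set ℤ
  tail : Set ℤ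

/-- The boxes of a soliton. -/
def Soliton.boxes (γ : Soliton) : Set ℤ := γ.head ∪ γ.tail

/-! ### The Head-Tail decomposition -/

/-- The run of the box `x` in the configuration `η` when the boxes in `R` are ignored (and the
remaining boxes are glued together): all boxes that remain and are separated from `x` by no
remaining box with a content different from that of `x`. -/
def runOf (η : BallConfiguration) (R : Set ℤ) (x : ℤ) : Set ℤ :=
  {y | y ∉ R ∧ ∀ z, z ∉ R → z ∈ Set.uIcc x y → η z = η x}

/-- `I` is a run of `η` when the boxes in `R` are ignored. Its size is `I.encard`. -/
def IsRun (η : BallConfiguration) (R : Set ℤ) (I : Set ℤ) : Prop :=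
  ∃ x, x ∉ R ∧ I = runOf η R x

/-- The remaining boxes form one single infinite run. -/
def SingleInfiniteRun (η : BallConfiguration) (R : Set ℤ) : Prop :=
  IsRun η R Rᶜ ∧ (Rᶜ).Infinite

/-- `I` is the leftmost among the smallest runs. -/
def IsLeftmostSmallestRun (η : BallConfiguration) (R : Set ℤ) (I : Set ℤ) : Prop :=
  IsRun η R I ∧ I.Finite ∧
    (∀ J, IsRun η R J → I.encard ≤ J.encard) ∧
    ∀ J, IsRun η R J → J.encard = I.encard → J ≠ I → ∀ x ∈ I, ∀ y ∈ J, x < y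

/-- `T` consists of the remaining boxes nearest to `I` on its right, as many as `I` has. -/
def IsNearestRight (R : Set ℤ) (I T : Set ℤ) : Prop :=
  T ⊆ Rᶜ ∧ T.encard = I.encard ∧ (∀ t ∈ T, ∀ x ∈ I, x < t) ∧
    ∀ t ∈ T, ∀ z, z ∉ R → (∀ x ∈ I, x < z) → z < t → z ∈ T

/-- `T` consists of the remaining boxes nearest to `I` on its left, as many as `I` has. -/
def IsNearestLeft (R : Set ℤ) (I T : Set ℤ) : Prop :=
  T ⊆ Rᶜ ∧ T.encard = I.encard ∧ (∀ t ∈ T, ∀ x ∈ I, t < x) ∧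
    ∀ t ∈ T, ∀ z, z ∉ R → (∀ x ∈ I, z < x) → t < z → z ∈ T

/-- `γ` is the soliton identified by one step of the Head-Tail algorithm when the boxes in `R` are
ignored: the leftmost smallest run is paired with the nearest boxes to its right if it is
occupied (these boxes have to be empty), and with the nearest boxes to its left if it is empty
(these boxes have to be occupied). -/
def IsHTSoliton (η : BallConfiguration) (R : Set ℤ) (γ : Soliton) : Prop :=
  ∃ I, IsLeftmostSmallestRun η R I ∧
    (((∀ x ∈ I, η x = true) ∧ γ.head = I ∧
        IsNearestRight R I γ.tail ∧ ∀ t ∈ γ.tail, η t = false) ∨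
      ((∀ x ∈ I, η x = false) ∧ γ.tail = I ∧
        IsNearestLeft R I γ.head ∧ ∀ t ∈ γ.head, η t = true))

/-- `HTAlgorithm η R Γ`: started on `η` with the boxes in `R` ignored, the Head-Tail algorithm stops
after finitely many steps and has then identified exactly the solitons in `Γ`. -/
inductive HTAlgorithm (η : BallConfiguration) : Set ℤ → Set Soliton → Prop
  | done (R : Set ℤ) : SingleInfiniteRun η R → HTAlgorithm η R ∅
  | step (R : Set ℤ) (γ : Soliton) (Γ : Set Soliton) : ¬ SingleInfiniteRun η R →
      IsHTSoliton η R γ → HTAlgorithm η (R ∪ γ.boxes) Γ → HTAlgorithm η R (insert γ Γ)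

/-- `Γ` is the Head-Tail soliton decomposition of the excursion `ε`. -/
def IsHTDecomposition (ε : SoftExcursion) (Γ : Set Soliton) : Prop :=
  HTAlgorithm ε.balls ∅ Γ

/-! ### The planar tree of an excursion and its branches -/

/-- The possible nodes of the tree: the root, which is the region below height `0`, and the regions
that horizontal lines at integer heights cut out of the region between height `0` and the graph.
`region a b` is the one whose left diagonal side is the step in box `a` and whose right
diagonal side is the step in box `b`. -/
inductive TreeNode
  | root
  | region (a b : ℤ)

/-- The horizontal position of a node, used to order the offspring of a node from left to right. -/
def TreeNode.position : TreeNode → ℤ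
  | .root => 0
  | .region a _ => a

/-- The nodes of the tree of `ε`. A non-root node is a connected component of the part of the epigraph
between two consecutive heights `h - 1` and `h`: it has the up-step in box `a` from `h - 1` to `h`
on its left, the down-step in box `b` from `h` to `h - 1` on its right, and the walk stays at
height at least `h` in between. -/
def IsNode (ε : SoftExcursion) : TreeNode → Prop
  | .root => True
  | .region a b => 0 < a ∧ a < b ∧ b ≤ 2 * (ε.n : ℤ) ∧ ε.walk a = ε.walk (a - 1) + 1 ∧
      ε.walk b = ε.walk (a - 1) ∧ ∀ i, a ≤ i → i < b → ε.walk a ≤ ε.walk i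

/-- `IsOffspring ε w v`: the node `w` is an offspring of `v`, that is, `w` lies directly above `v` and
the bottom side `[a - 1, b]` of `w` is a piece of the top side of `v`
(`[c, d - 1]` if `v = region c d`, and the line at height `0` if `v` is the root). -/
def IsOffspring (ε : SoftExcursion) : TreeNode → TreeNode → Prop
  | .root, _ => False
  | .region a b, .root => IsNode ε (.region a b) ∧ ε.walk (a - 1) = 0
  | .region a b, .region c d => IsNode ε (.region a b) ∧ IsNode ε (.region c d) ∧
      ε.walk (a - 1) = ε.walk c ∧ c ≤ a - 1 ∧ b ≤ d - 1

/-- A leaf: a node different from the root without offspring. -/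
def IsLeaf (ε : SoftExcursion) (v : TreeNode) : Prop :=
  IsNode ε v ∧ v ≠ .root ∧ ∀ w, ¬ IsOffspring ε w v

/-- Branch identification. `Colored ε v g c`: the non-root node `v` gets the generation number `g` and
the color `c`; the distinct colors of the leaves are the leaves themselves. A leaf gets generation
number `1` and its own color. A node all of whose offspring are numbered and colored gets the
color of the rightmost one among its offspring with the largest generation number, and a
generation number larger by one. -/
inductive Colored (ε : SoftExcursion) : TreeNode → ℕ → TreeNode → Prop
  | leaf (v : TreeNode) : IsLeaf ε v → Colored ε v 1 v
  | node (v w : TreeNode) (gen : TreeNode → ℕ) (col : TreeNode → TreeNode) : v ≠ .root →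
      (∀ u, IsOffspring ε u v → Colored ε u (gen u) (col u)) →
      IsOffspring ε w v →
      (∀ u, IsOffspring ε u v → gen u ≤ gen w) →
      (∀ u, IsOffspring ε u v → gen u = gen w → u.position ≤ w.position) →
      Colored ε v (gen w + 1) (col w)

/-- The branch with color `c`: all nodes of color `c`. -/
def branch (ε : SoftExcursion) (c : TreeNode) : Set TreeNode :=
  {v | ∃ g, Colored ε v g c}

/-- The soliton* of a branch: the boxes at the left (head) and at the right (tail) diagonal sides of
the regions of its nodes. -/
def branchSoliton (B : Set TreeNode) : Soliton where
  head := {a | ∃ b, TreeNode.region a b ∈ B}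
  tail := {b | ∃ a, TreeNode.region a b ∈ B}

/-- The soliton* decomposition of `ε`, induced by the branch decomposition of its tree. -/
def treeDecomposition (ε : SoftExcursion) : Set Soliton :=
  {γ | ∃ c, IsLeaf ε c ∧ γ = branchSoliton (branch ε c)}

end BoxBall

/-!
The non-root nodes of the tree of an excursion are the *arcs* `(a, b)` that match each up-step `a`
with a down-step `b`. Arcs do not cross, and the offspring of a node are the arcs directly inside it.
The generation number strictly increases along nested arcs, and every node that is not a leaf takes
its color from an heir, the offspring with the lexicographically largest pair
(generation number, position).

The proof follows the algorithm through its stages. A stage is a set `D` of nodes that have been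
removed; it is closed under passing to arcs inside and is a union of branches (`IsStage`). The
claim is that the next soliton is that of a whole branch and that removing it gives a stage again
(`IsStage.exists_branch_of_isHTSoliton`).

Let `H` and `T` be the head and the tail of the next soliton. All boxes that remain between them belong
to one of them, so by counting, the arcs match `H` with `T` (`IsStage.matching`), and the nodes so
obtained form a chain. Colors are passed along heirs, and the heir of a remaining node remains. Hence
all nodes of the chain have the color of its top, and the generation number of its lowest node `w` is
at most the size of `H`. It is left to see that `w` is not the heir of its parent, if this is not the
root (which has no color). The run before `H`
(if `H` is the leftmost smallest run) or after `T` (if `T` is) belongs to a sibling of `w`, whose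
generation number is at least the size of that run: the boxes of the run belong to nested arcs. In
the first case this run is strictly larger than `H`, because `H` is the leftmost among the smallest
runs; in the second case it is at least as large as `T`, and the sibling is to the right of `w`, so
that it wins the tie. Thus the two tie-breaking rules agree.

Conversely, as long as an occupied box remains there is a smallest run, it is finite, and its
neighbouring run provides the boxes to pair it with (`IsStage.exists_isHTSoliton`). As each step
removes boxes from a finite set, the algorithm stops.
-/

namespace BoxBall

variable {ε : SoftExcursion} {D : Set TreeNode} {a b c d : ℤ}

/-! ### Arcs of an excursion -/

/-- An arc of `ε`: an up-step (box `a`) together with the down-step (box `b`) matched with it, that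
is, the two sides of a non-root node of the tree. -/
abbrev IsArc (ε : SoftExcursion) (a b : ℤ) : Prop := IsNode ε (.region a b)

theorem balls_eq_true_iff {x : ℤ} : ε.balls x = true ↔
    0 < x ∧ x ≤ 2 * (ε.n : ℤ) ∧ ε.walk x - ε.walk (x - 1) = 1 := by
  simp [SoftExcursion.balls]

theorem walk_of_balls_eq_false {x : ℤ} (h : ε.balls x = false) (h0 : 0 < x)
    (h1 : x ≤ 2 * (ε.n : ℤ)) : ε.walk x = ε.walk (x - 1) - 1 := by
  have h2 : ¬ (ε.balls x = true) := by simp [h]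
  rw [balls_eq_true_iff] at h2
  rcases (abs_eq (by norm_num)).1 (ε.walk_step x h0 h1) with h3 | h3
  · exact absurd ⟨h0, h1, h3⟩ h2
  · linarith

theorem IsArc.balls_left (h : IsArc ε a b) : ε.balls a = true := by
  obtain ⟨h0, h1, h2, h3, -, -⟩ := h
  exact balls_eq_true_iff.2 ⟨h0, by linarith, by linarith⟩

theorem IsArc.balls_right (h : IsArc ε a b) : ε.balls b = false := by
  obtain ⟨h0, h1, h2, h3, h4, h5⟩ := h
  rw [← Bool.not_eq_true, balls_eq_true_iff]
  rintro ⟨-, -, h6⟩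
  linarith [h5 (b - 1) (by omega) (by omega)]

theorem IsArc.lt (h : IsArc ε a b) : a < b := h.2.1

theorem exists_arc_right (h : ε.balls a = true) : ∃ b, IsArc ε a b := by
  obtain ⟨h0, h1, h2⟩ := balls_eq_true_iff.1 h
  have hn := ε.walk_nonneg (a - 1) (by omega) (by omega)
  have hlt : a < 2 * (ε.n : ℤ) := by
    rcases h1.lt_or_eq with h | h
    · exact h
    · have := ε.walk_end
      rw [← h] at this
      linarith
  obtain ⟨b, ⟨hab, hb⟩, hmin⟩ := Int.exists_least_of_bdd
    (P := fun b => a < b ∧ ε.walk b ≤ ε.walk (a - 1)) ⟨a, fun z hz => hz.1.le⟩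
    ⟨2 * (ε.n : ℤ), hlt, by rw [ε.walk_end]; exact hn⟩
  have hbn : b ≤ 2 * (ε.n : ℤ) := hmin _ ⟨hlt, by rw [ε.walk_end]; exact hn⟩
  have hge : ∀ i, a ≤ i → i < b → ε.walk a ≤ ε.walk i := by
    intro i hi hib
    rcases hi.eq_or_lt with rfl | hi
    · exact le_rfl
    · by_contra hlt
      have := hmin i ⟨hi, by linarith⟩
      omega
  refine ⟨b, h0, hab, hbn, by linarith, ?_, hge⟩
  have h3 := hge (b - 1) (by omega) (by omega)
  have h4 := abs_le.1 (ε.walk_step b (by omega) hbn).le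
  linarith [h4.1]

theorem exists_arc_left (h : ε.balls b = false) (h0 : 0 < b) (h1 : b ≤ 2 * (ε.n : ℤ)) :
    ∃ a, IsArc ε a b := by
  have h2 := walk_of_balls_eq_false h h0 h1
  have hn := ε.walk_nonneg b h0.le h1
  have hlt : 1 < b := by
    rcases (show 1 ≤ b by omega).lt_or_eq with h | rfl
    · exact h
    · have := ε.walk_zero
      norm_num at h2
      linarith
  have hex : 0 < (1 : ℤ) ∧ 1 < b ∧ ε.walk (1 - 1) ≤ ε.walk b :=
    ⟨one_pos, hlt, by simpa [ε.walk_zero] using hn⟩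
  obtain ⟨a, ⟨ha0, hab, ha⟩, hmax⟩ := Int.exists_greatest_of_bdd
    (P := fun a => 0 < a ∧ a < b ∧ ε.walk (a - 1) ≤ ε.walk b) ⟨b, fun z hz => hz.2.1.le⟩ ⟨1, hex⟩
  have hgt : ∀ i, a ≤ i → i < b → ε.walk b < ε.walk i := by
    intro i hi hib
    by_contra hle
    rcases (show i + 1 ≤ b by omega).lt_or_eq with hi' | hi'
    · have := hmax (i + 1) ⟨by omega, hi', by simpa using not_lt.1 hle⟩
      omega
    · have : i = b - 1 := by omega
      subst this
      linarith
  have h3 := hgt a le_rfl hab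
  have h4 := abs_le.1 (ε.walk_step a ha0 (by omega)).le
  have h5 : ε.walk (a - 1) = ε.walk b := by linarith [h4.2]
  refine ⟨a, ha0, hab, h1, by linarith [h4.2], h5.symm, fun i hi hib => ?_⟩
  linarith [hgt i hi hib, h4.2]

theorem IsArc.right_unique (h : IsArc ε a b) (h' : IsArc ε a d) : b = d := by
  obtain ⟨-, h1, -, h3, h4, h5⟩ := h
  obtain ⟨-, h1', -, h3', h4', h5'⟩ := h'
  rcases lt_trichotomy b d with hlt | heq | hlt
  · linarith [h5' b h1.le hlt]
  · exact heq
  · linarith [h5 d h1'.le hlt]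

theorem IsArc.left_unique (h : IsArc ε a b) (h' : IsArc ε c b) : a = c := by
  obtain ⟨-, h1, -, h3, h4, h5⟩ := h
  obtain ⟨-, h1', -, h3', h4', h5'⟩ := h'
  rcases lt_trichotomy a c with hlt | heq | hlt
  · linarith [h5 (c - 1) (by omega) (by omega)]
  · exact heq
  · linarith [h5' (a - 1) (by omega) (by omega)]

theorem IsArc.left_ne_right (h : IsArc ε a b) (h' : IsArc ε c d) : a ≠ d := by
  rintro rfl
  exact absurd (h.balls_left.symm.trans h'.balls_right) (by simp)

/-- Arcs do not cross. -/
theorem IsArc.right_lt (h : IsArc ε a b) (h' : IsArc ε c d) (hac : a < c) (hcb : c < b) :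
    d < b := by
  by_contra hbd
  rcases (not_lt.1 hbd).eq_or_lt with rfl | hlt
  · exact hac.ne (h.left_unique h')
  · obtain ⟨-, -, -, h3, h4, h5⟩ := h
    obtain ⟨-, -, -, h3', h4', h5'⟩ := h'
    linarith [h5 (c - 1) (by omega) (by omega), h5' b hcb.le hlt]

/-- Arcs do not cross. -/
theorem IsArc.lt_left (h : IsArc ε a b) (h' : IsArc ε c d) (had : a < d) (hdb : d < b) :
    a < c := by
  rcases lt_trichotomy a c with hac | rfl | hac
  · exact hac
  · exact absurd (h.right_unique h') hdb.ne'
  · exact absurd (h'.right_lt h hac had) (by omega)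

/-! ### The offspring relation in terms of nested arcs -/

theorem IsOffspring.isArc_left {u : TreeNode} (h : IsOffspring ε (.region a b) u) :
    IsArc ε a b := by
  cases u
  · exact h.1
  · exact h.1

theorem IsOffspring.ne_root {u v : TreeNode} (h : IsOffspring ε u v) : u ≠ .root := by
  rintro rfl
  exact h

theorem IsOffspring.isNode {u v : TreeNode} (h : IsOffspring ε u v) : IsNode ε u := by
  cases u
  · exact trivial
  · exact h.isArc_left

theorem IsOffspring.inside (h : IsOffspring ε (.region a b) (.region c d)) : c < a ∧ b < d := by
  obtain ⟨-, -, -, h1, h2⟩ := h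
  omega

/-- An arc around an offspring of `(c, d)` is `(c, d)` itself or an arc around it. -/
theorem IsOffspring.le_of_inside {e f : ℤ} (h : IsOffspring ε (.region a b) (.region c d))
    (h' : IsArc ε e f) (hea : e < a) (hbf : b < f) : e ≤ c ∧ d ≤ f := by
  obtain ⟨hu, hv, hw, h1, h2⟩ := h
  replace hu : IsArc ε a b := hu
  replace hv : IsArc ε c d := hv
  have hab := hu.lt
  have hec : e ≤ c := by
    by_contra hlt
    have h3 := hv.2.2.2.2.2 (e - 1) (by omega) (by omega)
    have h4 := h'.2.2.2.2.2 (a - 1) (by omega) (by omega)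
    have h5 := h'.2.2.2.1
    linarith
  refine ⟨hec, ?_⟩
  rcases hec.eq_or_lt with rfl | hlt
  · exact (hv.right_unique h').le
  · exact (h'.right_lt hv hlt (by omega)).le

/-- Every arc inside `(c, d)` lies below an offspring of `(c, d)`. -/
theorem exists_offspring_around (hu : IsArc ε a b) (hv : IsArc ε c d) (hca : c < a) (hbd : b < d) :
    ∃ a' b', IsOffspring ε (.region a' b') (.region c d) ∧ a' ≤ a ∧ b ≤ b' := by
  have hab := hu.lt
  -- the offspring starts after the last visit of the walk to the height of `c` before box `a`
  obtain ⟨i, ⟨hci, hia, hwi⟩, hmax⟩ := Int.exists_greatest_of_bdd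
    (P := fun i => c ≤ i ∧ i < a ∧ ε.walk i = ε.walk c) ⟨a, fun z hz => hz.2.1.le⟩
    ⟨c, le_rfl, hca, rfl⟩
  have hgt : ∀ j, i < j → j ≤ a → ε.walk c < ε.walk j := by
    intro j hij hja
    have h1 := hv.2.2.2.2.2 j (by omega) (by omega)
    rcases hja.eq_or_lt with rfl | hja
    · linarith [hu.2.2.2.1, hv.2.2.2.2.2 (j - 1) (by omega) (by omega)]
    · refine lt_of_le_of_ne h1 fun h2 => ?_
      have := hmax j ⟨by omega, hja, h2.symm⟩
      omega
  have h1 := hv.1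
  have h2 := hv.2.2.1
  have hup : ε.balls (i + 1) = true := by
    refine balls_eq_true_iff.2 ⟨by omega, by omega, ?_⟩
    have h3 := hgt (i + 1) (by omega) (by omega)
    have h4 := (abs_le.1 (ε.walk_step (i + 1) (by omega) (by omega)).le).2
    simp only [add_sub_cancel_right] at h4 ⊢
    linarith
  obtain ⟨b', hb'⟩ := exists_arc_right hup
  have hlt := hb'.lt
  have hb'd : b' < d := hv.right_lt hb' (by omega) (by omega)
  have hab' : a < b' := by
    by_contra hle
    have h3 := hgt b' (by omega) (by omega)
    have h4 := hb'.2.2.2.2.1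
    simp only [add_sub_cancel_right] at h4
    linarith
  refine ⟨i + 1, b', ⟨hb', hv, by simpa using hwi, by omega, by omega⟩, by omega, ?_⟩
  rcases (show i + 1 ≤ a by omega).eq_or_lt with h3 | h3
  · subst h3
    exact (hu.right_unique hb').le
  · exact (hb'.right_lt hu h3 hab').le

/-! ### Generation numbers and colors -/

theorem IsNode.eq_of_position_eq {u v : TreeNode} (hu : IsNode ε u) (hv : IsNode ε v)
    (hur : u ≠ .root) (hvr : v ≠ .root) (h : u.position = v.position) : u = v := by
  cases u with
  | root => exact absurd rfl hur
  | region a b =>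
    cases v with
    | root => exact absurd rfl hvr
    | region c d =>
      obtain rfl : a = c := h
      obtain rfl := IsArc.right_unique hu hv
      rfl

theorem Colored.unique {v : TreeNode} {g : ℕ} {c : TreeNode} (h : Colored ε v g c) :
    ∀ {g' : ℕ} {c' : TreeNode}, Colored ε v g' c' → g = g' ∧ c = c' := by
  induction h with
  | leaf v hv =>
    intro g' c' h'
    cases h' with
    | leaf => exact ⟨rfl, rfl⟩
    | node _ w gen col _ _ hw => exact absurd hw (hv.2.2 w)
  | node v w gen col hv hc hw hmax hright ih =>
    intro g' c' h'
    cases h' with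
    | leaf _ hl => exact absurd hw (hl.2.2 w)
    | node _ w' gen' col' hv' hc' hw' hmax' hright' =>
      have e1 := ih w hw (hc' w hw)
      have e2 := ih w' hw' (hc' w' hw')
      have hg : gen w = gen w' := by
        apply le_antisymm
        · rw [e1.1, e2.1]
          exact hmax' w hw
        · exact hmax w' hw'
      obtain rfl : w = w' := by
        refine hw.isNode.eq_of_position_eq hw'.isNode hw.ne_root hw'.ne_root (le_antisymm ?_ ?_)
        · exact hright' w hw (by rw [← e1.1, ← e2.1, hg])
        · exact hright w' hw' hg.symm
      exact ⟨by rw [e1.1], e1.2⟩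

theorem finite_setOf_isOffspring (v : TreeNode) : {u | IsOffspring ε u v}.Finite := by
  refine Set.Finite.subset (((Set.finite_Icc (0 : ℤ) (2 * ε.n)).prod
    (Set.finite_Icc (0 : ℤ) (2 * ε.n))).image fun p => TreeNode.region p.1 p.2) ?_
  intro u hu
  cases u with
  | root => exact absurd rfl (IsOffspring.ne_root (ε := ε) (v := v) hu)
  | region a b =>
    have h := IsOffspring.isArc_left hu
    have h1 := h.1
    have h2 := h.2.1
    have h3 := h.2.2.1
    exact ⟨(a, b), ⟨⟨by omega, by omega⟩, ⟨by omega, by omega⟩⟩, rfl⟩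

theorem IsArc.exists_colored (h : IsArc ε a b) : ∃ g c, Colored ε (.region a b) g c := by
  induction hN : (b - a).toNat using Nat.strong_induction_on generalizing a b with
  | _ N ih =>
    by_cases hl : ∃ w, IsOffspring ε w (.region a b)
    · have hc : ∀ u, IsOffspring ε u (.region a b) → ∃ g c, Colored ε u g c := by
        intro u hu
        cases u with
        | root => exact absurd rfl hu.ne_root
        | region x y =>
          have h1 := hu.inside
          have h2 := hu.isArc_left.lt
          exact ih (y - x).toNat (by omega) hu.isArc_left rfl
      choose! gen col hcol using hc
      have hfin := finite_setOf_isOffspring (ε := ε) (.region a b)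
      -- the winner is the maximum for the lexicographic order on (generation number, position)
      obtain ⟨w, hw, hmax⟩ := Set.exists_max_image _
        (fun u : TreeNode => toLex (gen u, u.position)) hfin hl
      refine ⟨_, _, .node _ w gen col (by simp) hcol hw (fun u hu => ?_) fun u hu hg => ?_⟩
      · rcases Prod.Lex.toLex_le_toLex.1 (hmax u hu) with h1 | h1
        · exact h1.le
        · exact h1.1.le
      · rcases Prod.Lex.toLex_le_toLex.1 (hmax u hu) with h1 | h1
        · exact absurd hg h1.ne
        · exact h1.2
    · exact ⟨1, _, .leaf _ ⟨h, by simp, not_exists.1 hl⟩⟩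

open Classical in
/-- The generation number of a node (`0` for the root, which gets none). -/
noncomputable def generation (ε : SoftExcursion) (v : TreeNode) : ℕ :=
  if h : ∃ g c, Colored ε v g c then h.choose else 0

open Classical in
/-- The color of a node (by convention the root itself for the root, which gets none). -/
noncomputable def color (ε : SoftExcursion) (v : TreeNode) : TreeNode :=
  if h : ∃ c g, Colored ε v g c then h.choose else .root

theorem Colored.generation_eq {v c : TreeNode} {g : ℕ} (h : Colored ε v g c) :
    generation ε v = g := by
  have h' : ∃ g c, Colored ε v g c := ⟨g, c, h⟩
  rw [generation, dif_pos h']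
  exact (h'.choose_spec.choose_spec.unique h).1

theorem Colored.color_eq {v c : TreeNode} {g : ℕ} (h : Colored ε v g c) : color ε v = c := by
  have h' : ∃ c g, Colored ε v g c := ⟨c, g, h⟩
  rw [color, dif_pos h']
  exact (h'.choose_spec.choose_spec.unique h).2

theorem IsArc.colored (h : IsArc ε a b) :
    Colored ε (.region a b) (generation ε (.region a b)) (color ε (.region a b)) := by
  obtain ⟨g, c, hc⟩ := h.exists_colored
  rwa [hc.generation_eq, hc.color_eq]

/-- `(a, b)` is the offspring of `v` from which `v` inherits its color. -/
structure IsHeir (ε : SoftExcursion) (a b : ℤ) (v : TreeNode) : Prop where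
  offspring : IsOffspring ε (.region a b) v
  generation_eq : generation ε v = generation ε (.region a b) + 1
  color_eq : color ε v = color ε (.region a b)
  le : ∀ x y, IsOffspring ε (.region x y) v →
    generation ε (.region x y) ≤ generation ε (.region a b)
  position_le : ∀ x y, IsOffspring ε (.region x y) v →
    generation ε (.region x y) = generation ε (.region a b) → x ≤ a

theorem IsLeaf.color_eq {v : TreeNode} (h : IsLeaf ε v) : color ε v = v :=
  (Colored.leaf v h).color_eq

theorem IsArc.leaf_or_exists_heir (h : IsArc ε a b) :
    IsLeaf ε (.region a b) ∧ generation ε (.region a b) = 1 ∨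
      ∃ x y, IsHeir ε x y (.region a b) := by
  have hc := h.colored
  generalize hg : generation ε (.region a b) = g at hc ⊢
  generalize hk : color ε (.region a b) = k at hc
  cases hc with
  | leaf _ hl => exact .inl ⟨hl, rfl⟩
  | node _ w gen col hv hc hw hmax hright =>
    cases w with
    | root => exact absurd rfl hw.ne_root
    | region x y =>
      have hgen : ∀ u, IsOffspring ε u (.region a b) → generation ε u = gen u :=
        fun u hu => (hc u hu).generation_eq
      refine .inr ⟨x, y, hw, by rw [hg, hgen _ hw], by rw [hk, (hc _ hw).color_eq],
        fun p q hu => ?_, fun p q hu he => ?_⟩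
      · rw [hgen _ hu, hgen _ hw]
        exact hmax _ hu
      · rw [hgen _ hu, hgen _ hw] at he
        exact hright _ hu he

theorem IsOffspring.generation_lt (h : IsOffspring ε (.region a b) (.region c d)) :
    generation ε (.region a b) < generation ε (.region c d) := by
  rcases IsArc.leaf_or_exists_heir h.2.1 with ⟨hl, -⟩ | ⟨x, y, hh⟩
  · exact absurd h (hl.2.2 _)
  · rw [hh.generation_eq]
    exact Nat.lt_succ_of_le (hh.le _ _ h)

theorem IsArc.generation_pos (h : IsArc ε a b) : 0 < generation ε (.region a b) := by
  rcases h.leaf_or_exists_heir with ⟨-, hl⟩ | ⟨x, y, hh⟩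
  · omega
  · rw [hh.generation_eq]
    omega

theorem IsArc.generation_lt (hu : IsArc ε a b) (hv : IsArc ε c d) (hca : c < a) (hbd : b < d) :
    generation ε (.region a b) < generation ε (.region c d) := by
  induction hN : (d - c).toNat using Nat.strong_induction_on generalizing c d with
  | _ N ih =>
    obtain ⟨x, y, ho, hx, hy⟩ := exists_offspring_around hu hv hca hbd
    have h1 := ho.inside
    have h2 := hu.lt
    rcases hx.eq_or_lt with rfl | hx
    · obtain rfl := hu.right_unique ho.isArc_left
      exact ho.generation_lt
    · have hby : b < y := ho.isArc_left.right_lt hu hx (by omega)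
      exact (ih (y - x).toNat (by omega) ho.isArc_left hx hby rfl).trans ho.generation_lt

theorem IsArc.isLeaf_color (h : IsArc ε a b) : IsLeaf ε (color ε (.region a b)) := by
  induction hN : (b - a).toNat using Nat.strong_induction_on generalizing a b with
  | _ N ih =>
    rcases h.leaf_or_exists_heir with ⟨hl, -⟩ | ⟨x, y, hh⟩
    · rwa [hl.color_eq]
    · have h1 := hh.offspring.inside
      have h2 := hh.offspring.isArc_left.lt
      rw [hh.color_eq]
      exact ih (y - x).toNat (by omega) hh.offspring.isArc_left rfl

theorem not_colored_root {g : ℕ} {k : TreeNode} : ¬ Colored ε .root g k := by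
  intro h
  cases h with
  | leaf _ hl => exact hl.2.1 rfl
  | node _ w gen col hv => exact hv rfl

theorem Colored.isNode {v k : TreeNode} {g : ℕ} (h : Colored ε v g k) : IsNode ε v := by
  cases h with
  | leaf _ hl => exact hl.1
  | node _ w gen col hv hc hw =>
    cases v with
    | root => trivial
    | region c d =>
      cases w with
      | root => exact absurd rfl hw.ne_root
      | region a b => exact hw.2.1

theorem root_notMem_branch (k : TreeNode) : TreeNode.root ∉ branch ε k :=
  fun ⟨_, h⟩ => not_colored_root h

theorem region_mem_branch_iff {k : TreeNode} :
    .region a b ∈ branch ε k ↔ IsArc ε a b ∧ color ε (.region a b) = k := by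
  constructor
  · rintro ⟨g, h⟩
    exact ⟨h.isNode, h.color_eq⟩
  · rintro ⟨h, rfl⟩
    exact ⟨_, h.colored⟩

/-! ### Runs -/

section Runs

variable {η : BallConfiguration} {R : Set ℤ} {x y z : ℤ}

theorem mem_runOf_self (hx : x ∉ R) : x ∈ runOf η R x := by
  refine ⟨hx, fun z _ hz => ?_⟩
  rw [Set.uIcc_self, Set.mem_singleton_iff] at hz
  rw [hz]

theorem apply_eq_of_mem_runOf (hy : y ∈ runOf η R x) : η y = η x :=
  hy.2 y hy.1 Set.right_mem_uIcc

theorem mem_runOf_of_mem_uIcc {w : ℤ} (hy : y ∈ runOf η R x) (hz : z ∈ runOf η R x) (hw : w ∉ R)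
    (h : w ∈ Set.uIcc y z) : w ∈ runOf η R x := by
  have key : ∀ u, u ∉ R → u ∈ Set.uIcc y z → η u = η x := by
    intro u hu hm
    rcases Set.uIcc_subset_uIcc_union_uIcc (b := x) hm with h1 | h1
    · exact hy.2 u hu (by rwa [Set.uIcc_comm])
    · exact hz.2 u hu h1
  refine ⟨hw, fun u hu hm => ?_⟩
  rcases Set.uIcc_subset_uIcc_union_uIcc (b := y) hm with h1 | h1
  · exact hy.2 u hu h1
  · exact key u hu (Set.uIcc_subset_uIcc Set.left_mem_uIcc h h1)

theorem mem_runOf_of_mem_Icc {w : ℤ} (hy : y ∈ runOf η R x) (hz : z ∈ runOf η R x) (hw : w ∉ R)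
    (h1 : y ≤ w) (h2 : w ≤ z) : w ∈ runOf η R x :=
  mem_runOf_of_mem_uIcc hy hz hw (Set.Icc_subset_uIcc ⟨h1, h2⟩)

theorem runOf_eq (hy : y ∈ runOf η R x) : runOf η R y = runOf η R x := by
  ext z
  constructor
  · intro hz
    refine ⟨hz.1, fun u hu hm => ?_⟩
    rcases Set.uIcc_subset_uIcc_union_uIcc (b := y) hm with h1 | h1
    · exact hy.2 u hu h1
    · exact (hz.2 u hu h1).trans (apply_eq_of_mem_runOf hy)
  · intro hz
    refine ⟨hz.1, fun u hu hm => ?_⟩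
    exact (apply_eq_of_mem_runOf (mem_runOf_of_mem_uIcc hy hz hu hm)).trans
      (apply_eq_of_mem_runOf hy).symm

/-- A remaining box next to a run and with the same content belongs to the run. -/
theorem mem_runOf_of_adjacent (hy : y ∈ runOf η R x) (hz : z ∉ R) (he : η z = η y)
    (h : ∀ w, w ∉ R → w ∈ Set.uIcc y z → w = z ∨ w ∈ runOf η R x) : z ∈ runOf η R x := by
  have hyx := apply_eq_of_mem_runOf hy
  refine ⟨hz, fun u hu hm => ?_⟩
  rcases Set.uIcc_subset_uIcc_union_uIcc (b := y) hm with h1 | h1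
  · exact hy.2 u hu h1
  · rcases h u hu h1 with rfl | h2
    · rw [he, hyx]
    · exact apply_eq_of_mem_runOf h2

end Runs

/-! ### Stages of the algorithm -/

/-- A set `D` of non-root nodes that may have been removed by the Head-Tail algorithm: it contains
all the nodes above its members, and it is a union of branches. -/
structure IsStage (ε : SoftExcursion) (D : Set TreeNode) : Prop where
  root_notMem : TreeNode.root ∉ D
  isArc : ∀ {a b}, .region a b ∈ D → IsArc ε a b
  mem_of_inside : ∀ {a b c d}, .region a b ∈ D → IsArc ε c d → a < c → d < b → .region c d ∈ D
  mem_of_color_eq : ∀ {a b c d}, .region a b ∈ D → IsArc ε c d →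
    color ε (.region a b) = color ε (.region c d) → .region c d ∈ D

/-- The boxes of the nodes in `D`. -/
def removed (D : Set TreeNode) : Set ℤ := (branchSoliton D).boxes


theorem IsStage.left_mem_removed (hD : IsStage ε D) (h : IsArc ε a b) :
    a ∈ removed D ↔ .region a b ∈ D := by
  refine ⟨?_, fun h' => .inl ⟨b, h'⟩⟩
  rintro (⟨y, hy⟩ | ⟨x, hx⟩)
  · rwa [h.right_unique (hD.isArc hy)]
  · exact absurd rfl (h.left_ne_right (hD.isArc hx))

theorem IsStage.right_mem_removed (hD : IsStage ε D) (h : IsArc ε a b) :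
    b ∈ removed D ↔ .region a b ∈ D := by
  refine ⟨?_, fun h' => .inr ⟨a, h'⟩⟩
  rintro (⟨y, hy⟩ | ⟨x, hx⟩)
  · exact absurd rfl ((hD.isArc hy).left_ne_right h)
  · rwa [h.left_unique (hD.isArc hx)]

theorem IsStage.Icc_of_mem_removed (hD : IsStage ε D) {x : ℤ} (h : x ∈ removed D) :
    0 < x ∧ x ≤ 2 * (ε.n : ℤ) := by
  rcases h with ⟨y, hy⟩ | ⟨y, hy⟩
  all_goals
    have h1 := (hD.isArc hy).1
    have h2 := (hD.isArc hy).2.1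
    have h3 := (hD.isArc hy).2.2.1
    constructor <;> omega

theorem balls_eq_false_of_notMem {x : ℤ} (h : ¬ (0 < x ∧ x ≤ 2 * (ε.n : ℤ))) :
    ε.balls x = false := by
  rw [← Bool.not_eq_true, balls_eq_true_iff]
  exact fun h' => h ⟨h'.1, h'.2.1⟩

/-- Let `H` be a set of occupied and `T` an equally large set of empty boxes on its right, such that
no other boxes remain between boxes of `H` and of `T`. Then the arcs match `H` with `T`. -/
theorem IsStage.matching (hD : IsStage ε D) {H T : Set ℤ} (hfin : H.Finite)
    (hcard : T.encard = H.encard) (hH : ∀ x ∈ H, x ∉ removed D ∧ ε.balls x = true)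
    (hT : ∀ t ∈ T, t ∉ removed D ∧ ε.balls t = false) (hlt : ∀ x ∈ H, ∀ t ∈ T, x < t)
    (hconv : ∀ z, z ∉ removed D → ∀ x ∈ H, ∀ t ∈ T, x ≤ z → z ≤ t → z ∈ H ∪ T) :
    (∀ x ∈ H, ∀ y, IsArc ε x y → y ∈ T) ∧ ∀ t ∈ T, ∃ x ∈ H, IsArc ε x t := by
  have key : ∀ x ∈ H, ∀ y, IsArc ε x y → y ∈ T := by
    intro x hx y hxy
    by_contra hy
    have hyR : y ∉ removed D := by
      rw [hD.right_mem_removed hxy, ← hD.left_mem_removed hxy]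
      exact (hH x hx).1
    -- otherwise the arc of `x` passes over `T`, and `T` is matched with a part of `H \ {x}`
    have hTy : ∀ t ∈ T, t < y := by
      intro t ht
      by_contra hyt
      rcases hconv y hyR x hx t ht hxy.lt.le (not_lt.1 hyt) with h | h
      · exact absurd ((hH y h).2.symm.trans hxy.balls_right) (by simp)
      · exact hy h
    have hpartner : ∀ t ∈ T, ∃ s, s ∈ H \ {x} ∧ IsArc ε s t := by
      intro t ht
      have hxt := hlt x hx t ht
      have hx0 := hxy.1
      have hyn := hxy.2.2.1
      have hty := hTy t ht
      obtain ⟨s, hs⟩ := exists_arc_left (hT t ht).2 (by omega) (by omega)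
      have hxs := hxy.lt_left hs hxt hty
      have hsR : s ∉ removed D := by
        rw [hD.left_mem_removed hs, ← hD.right_mem_removed hs]
        exact (hT t ht).1
      refine ⟨s, ⟨?_, fun h => hxs.ne' h⟩, hs⟩
      rcases hconv s hsR x hx t ht hxs.le hs.lt.le with h | h
      · exact h
      · exact absurd ((hT s h).2.symm.trans hs.balls_left) (by simp)
    choose! f hf using hpartner
    have h1 : T.encard ≤ (H \ {x}).encard := by
      refine Set.encard_le_encard_of_injOn (f := f) (fun t ht => (hf t ht).1) ?_
      intro t ht t' ht' h
      have h2 := (hf t ht).2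
      rw [h] at h2
      exact h2.right_unique (hf t' ht').2
    have h2 : (H \ {x}).encard < H.encard :=
      hfin.sdiff.encard_lt_encard ⟨Set.sdiff_subset, fun h => (h hx).2 rfl⟩
    exact absurd (hcard ▸ h1) (not_le.2 h2)
  refine ⟨key, ?_⟩
  have hex : ∀ x ∈ H, ∃ y, IsArc ε x y := fun x hx => exists_arc_right (hH x hx).2
  choose! f hf using hex
  have hinj : Set.InjOn f H := by
    intro x hx x' hx' h
    have h2 := hf x hx
    rw [h] at h2
    exact h2.left_unique (hf x' hx')
  have hsub : f '' H ⊆ T := by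
    rintro _ ⟨x, hx, rfl⟩
    exact key x hx _ (hf x hx)
  have heq : f '' H = T := by
    refine (hfin.image f).eq_of_subset_of_encard_le hsub ?_
    rw [hinj.encard_image, hcard]
  intro t ht
  rw [← heq] at ht
  obtain ⟨x, hx, rfl⟩ := ht
  exact ⟨x, hx, hf x hx⟩

/-! ### Siblings next to a run -/

/-- The last remaining box before a remaining node `(a, b)`, if empty, ends a sibling of `(a, b)` on the
left. -/
theorem IsStage.left_sibling (hD : IsStage ε D) (hw : IsOffspring ε (.region a b) (.region c d))
    (hvD : TreeNode.region c d ∉ D) {z : ℤ} (hzR : z ∉ removed D)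
    (hza : z < a) (hz : ∀ y, y ∉ removed D → z < y → a ≤ y) (hzf : ε.balls z = false) :
    ∃ p, IsOffspring ε (.region p z) (.region c d) := by
  obtain ⟨hca, hbd⟩ := hw.inside
  have hab : IsArc ε a b := hw.isArc_left
  have hcd : IsArc ε c d := hw.2.1
  have hcR : c ∉ removed D := by rwa [hD.left_mem_removed hcd]
  have hcz : c < z := by
    rcases lt_trichotomy c z with h | rfl | h
    · exact h
    · exact absurd (hzf.symm.trans hcd.balls_left) (by simp)
    · exact absurd (hz c hcR h) (by omega)
  have h1 := hcd.1
  have h2 := hcd.2.2.1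
  have h3 := hab.lt
  obtain ⟨p, hp⟩ := exists_arc_left hzf (by omega) (by omega)
  obtain ⟨p', z', ho, hp', hz'⟩ :=
    exists_offspring_around hp hcd (hcd.lt_left hp hcz (by omega)) (by omega)
  have ha' : IsArc ε p' z' := ho.isArc_left
  have hpz := hp.lt
  have hz'a : z' < a := by
    by_contra hle
    have hne := hab.left_ne_right ha'
    have h4 := ha'.right_lt hab (by omega) (by omega)
    have h5 := hw.le_of_inside ha' (by omega) h4
    have h6 := ho.inside
    omega
  have hz'R : z' ∉ removed D := by
    rw [hD.right_mem_removed ha']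
    intro h4
    have hpD : TreeNode.region p z ∉ D := by rwa [← hD.right_mem_removed hp]
    rcases hz'.eq_or_lt with rfl | hlt
    · exact hpD (by rwa [hp.left_unique ha'])
    · exact hpD (hD.mem_of_inside h4 hp (ha'.lt_left hp (by omega) hlt) hlt)
  obtain rfl : z' = z := by
    rcases hz'.eq_or_lt with h | h
    · exact h.symm
    · exact absurd (hz z' hz'R h) (by omega)
  exact ⟨p', ho⟩

/-- The first remaining box after a remaining node `(a, b)`, if occupied, starts a sibling of `(a, b)`
on the right. -/
theorem IsStage.right_sibling (hD : IsStage ε D) (hw : IsOffspring ε (.region a b) (.region c d))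
    (hvD : TreeNode.region c d ∉ D) {z : ℤ} (hzR : z ∉ removed D)
    (hbz : b < z) (hz : ∀ y, y ∉ removed D → y < z → y ≤ b) (hzt : ε.balls z = true) :
    ∃ q, IsOffspring ε (.region z q) (.region c d) := by
  obtain ⟨hca, hbd⟩ := hw.inside
  have hab : IsArc ε a b := hw.isArc_left
  have hcd : IsArc ε c d := hw.2.1
  have hdR : d ∉ removed D := by rwa [hD.right_mem_removed hcd]
  have hzd : z < d := by
    rcases lt_trichotomy z d with h | rfl | h
    · exact h
    · exact absurd (hzt.symm.trans hcd.balls_right) (by simp)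
    · exact absurd (hz d hdR h) (by omega)
  have h3 := hab.lt
  obtain ⟨q, hq⟩ := exists_arc_right hzt
  obtain ⟨z', q', ho, hz', hq'⟩ :=
    exists_offspring_around hq hcd (by omega) (hcd.right_lt hq (by omega) hzd)
  have ha' : IsArc ε z' q' := ho.isArc_left
  have hzq := hq.lt
  have hbz' : b < z' := by
    by_contra hle
    have hne := ha'.left_ne_right hab
    have h4 := ha'.lt_left hab (by omega) (by omega)
    have h5 := hw.le_of_inside ha' h4 (by omega)
    have h6 := ho.inside
    omega
  have hz'R : z' ∉ removed D := by
    rw [hD.left_mem_removed ha']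
    intro h4
    have hqD : TreeNode.region z q ∉ D := by rwa [← hD.left_mem_removed hq]
    rcases hz'.eq_or_lt with rfl | hlt
    · exact hqD (by rwa [hq.right_unique ha'])
    · exact hqD (hD.mem_of_inside h4 hq hlt (ha'.right_lt hq hlt (by omega)))
  obtain rfl : z' = z := by
    rcases hz'.eq_or_lt with h | h
    · exact h
    · exact absurd (hz z' hz'R h) (by omega)
  exact ⟨q', ho⟩

/-- The generation numbers of nested arcs are distinct, so there are at most as many of these arcs as any
common bound of their generation numbers. The arcs are indexed by a set `J` of boxes. -/
theorem encard_le_generation {u : TreeNode} {J : Set ℤ} (l r : ℤ → ℤ)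
    (harc : ∀ j ∈ J, IsArc ε (l j) (r j))
    (hnest : ∀ i ∈ J, ∀ j ∈ J, i < j →
      l i < l j ∧ r j < r i ∨ l j < l i ∧ r i < r j)
    (hle : ∀ j ∈ J, generation ε (.region (l j) (r j)) ≤ generation ε u) :
    J.encard ≤ generation ε u := by
  have h1 : J.encard ≤ (Set.Icc 1 (generation ε u)).encard := by
    refine Set.encard_le_encard_of_injOn
      (f := fun j => generation ε (.region (l j) (r j)))
      (fun j hj => ⟨(harc j hj).generation_pos, hle j hj⟩) ?_
    have key : ∀ i ∈ J, ∀ j ∈ J, i < j →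
        generation ε (.region (l i) (r i)) ≠ generation ε (.region (l j) (r j)) := by
      intro i hi j hj hij
      rcases hnest i hi j hj hij with h | h
      · exact ((harc j hj).generation_lt (harc i hi) h.1 h.2).ne'
      · exact ((harc i hi).generation_lt (harc j hj) h.1 h.2).ne
    intro i hi j hj h
    rcases lt_trichotomy i j with hij | rfl | hij
    · exact absurd h (key i hi j hj hij)
    · rfl
    · exact absurd h.symm (key j hj i hi hij)
  refine h1.trans (le_of_eq ?_)
  rw [← Finset.coe_Icc, Set.encard_coe_eq_coe_finsetCard, Nat.card_Icc, Nat.add_sub_cancel]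

/-- An empty run that ends with the box `z` of the node `(p, z)` is at most as large as the generation
number of this node. -/
theorem IsStage.encard_le_generation_left (hD : IsStage ε D) {p z : ℤ} (hp : IsArc ε p z)
    (hmax : ∀ y ∈ runOf ε.balls (removed D) z, y ≤ z)
    (hpR : p ∉ removed D) : (runOf ε.balls (removed D) z).encard ≤ generation ε (.region p z) := by
  set J := runOf ε.balls (removed D) z with hJ
  have hzJ : z ∈ J := mem_runOf_self (by
    rwa [hD.right_mem_removed hp, ← hD.left_mem_removed hp])
  have hf : ∀ j ∈ J, ε.balls j = false := fun j hj =>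
    (apply_eq_of_mem_runOf hj).trans hp.balls_right
  have hpj : ∀ j ∈ J, p < j := by
    intro j hj
    by_contra hle
    exact absurd ((hf p (mem_runOf_of_mem_Icc hj hzJ hpR (not_lt.1 hle) hp.lt.le)).symm.trans
      hp.balls_left) (by simp)
  have hex : ∀ j ∈ J, ∃ x, IsArc ε x j := by
    intro j hj
    have h1 := hpj j hj
    have h2 := hmax j hj
    have h3 := hp.1
    have h4 := hp.2.2.1
    exact exists_arc_left (hf j hj) (by omega) (by omega)
  choose! f hfarc using hex
  have hnest : ∀ i ∈ J, ∀ j ∈ J, i < j → f j < f i := by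
    intro i hi j hj hij
    refine (hfarc j hj).lt_left (hfarc i hi) ?_ hij
    by_contra hle
    have hR : f j ∉ removed D := by
      rw [hD.left_mem_removed (hfarc j hj), ← hD.right_mem_removed (hfarc j hj)]
      exact hj.1
    exact absurd ((hf _ (mem_runOf_of_mem_Icc hi hj hR (not_lt.1 hle)
      (hfarc j hj).lt.le)).symm.trans (hfarc j hj).balls_left) (by simp)
  refine encard_le_generation f id hfarc
    (fun i hi j hj hij => .inr ⟨hnest i hi j hj hij, hij⟩) fun j hj => ?_
  have hfz : f z = p := (hfarc z hzJ).left_unique hp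
  rcases (hmax j hj).eq_or_lt with rfl | hlt
  · rw [hfz, id]
  · exact ((hfarc j hj).generation_lt hp (hfz ▸ hnest j hj z hzJ hlt) hlt).le

/-- An occupied run that starts with the box `z` of the node `(z, q)` is at most as large as the
generation number of this node. -/
theorem IsStage.encard_le_generation_right (hD : IsStage ε D) {z q : ℤ} (hq : IsArc ε z q)
    (hmin : ∀ y ∈ runOf ε.balls (removed D) z, z ≤ y)
    (hqR : q ∉ removed D) : (runOf ε.balls (removed D) z).encard ≤ generation ε (.region z q) := by
  set J := runOf ε.balls (removed D) z with hJ
  have hzJ : z ∈ J := mem_runOf_self (by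
    rwa [hD.left_mem_removed hq, ← hD.right_mem_removed hq])
  have ht : ∀ j ∈ J, ε.balls j = true := fun j hj =>
    (apply_eq_of_mem_runOf hj).trans hq.balls_left
  have hex : ∀ j ∈ J, ∃ y, IsArc ε j y := fun j hj => exists_arc_right (ht j hj)
  choose! f hfarc using hex
  have hnest : ∀ i ∈ J, ∀ j ∈ J, i < j → f j < f i := by
    intro i hi j hj hij
    refine (hfarc i hi).right_lt (hfarc j hj) hij ?_
    by_contra hle
    have hR : f i ∉ removed D := by
      rw [hD.right_mem_removed (hfarc i hi), ← hD.left_mem_removed (hfarc i hi)]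
      exact hi.1
    exact absurd ((ht _ (mem_runOf_of_mem_Icc hi hj hR (hfarc i hi).lt.le
      (not_lt.1 hle))).symm.trans (hfarc i hi).balls_right) (by simp)
  refine encard_le_generation id f hfarc
    (fun i hi j hj hij => .inl ⟨hij, hnest i hi j hj hij⟩) fun j hj => ?_
  have hfz : f z = q := (hfarc z hzJ).right_unique hq
  rcases (hmin j hj).eq_or_lt with rfl | hlt
  · rw [hfz, id]
  · exact ((hfarc j hj).generation_lt hq hlt (hfz ▸ hnest z hzJ j hj hlt)).le

/-! ### Nested arcs that form a branch -/

/-- Let `H` and `T` be as in `IsStage.matching`. Then the arcs between `H` and `T` form a branch,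
provided that the outermost of them is not the heir of a remaining node; in checking this, one may
assume that its generation number is at most the size of `H`. -/
theorem IsStage.exists_branch (hD : IsStage ε D) {H T : Set ℤ} (hfin : H.Finite)
    (hne : H.Nonempty)
    (hcard : T.encard = H.encard) (hH : ∀ x ∈ H, x ∉ removed D ∧ ε.balls x = true)
    (hT : ∀ t ∈ T, t ∉ removed D ∧ ε.balls t = false) (hlt : ∀ x ∈ H, ∀ t ∈ T, x < t)
    (hconv : ∀ z, z ∉ removed D → ∀ x ∈ H, ∀ t ∈ T, x ≤ z → z ≤ t → z ∈ H ∪ T)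
    (hroot : ∀ x ∈ H, (∀ x' ∈ H, x ≤ x') → ∀ y ∈ T, (∀ t ∈ T, t ≤ y) →
      (generation ε (.region x y) : ℕ∞) ≤ H.encard → ∀ c d,
      .region c d ∉ D → ¬ IsHeir ε x y (.region c d)) :
    ∃ k, IsLeaf ε k ∧ k ∉ D ∧ H = (branchSoliton (branch ε k)).head ∧
      T = (branchSoliton (branch ε k)).tail ∧ IsStage ε (D ∪ branch ε k) := by
  obtain ⟨hHT, hTH⟩ := hD.matching hfin hcard hH hT hlt hconv
  have hnotD : ∀ {x y}, x ∈ H → IsArc ε x y → TreeNode.region x y ∉ D := by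
    intro x y hx hxy
    rw [← hD.left_mem_removed hxy]
    exact (hH x hx).1
  obtain ⟨m, hm, hmmax⟩ := Set.exists_max_image H id hfin hne
  obtain ⟨x₀, hx₀, hmin⟩ := Set.exists_min_image H id hfin hne
  obtain ⟨m', hmm'⟩ := exists_arc_right (hH m hm).2
  obtain ⟨y₀, hxy₀⟩ := exists_arc_right (hH x₀ hx₀).2
  have hy₀ := hHT x₀ hx₀ _ hxy₀
  simp only [id] at hmmax hmin
  have hnest : ∀ {x y x' y'}, IsArc ε x y → IsArc ε x' y' → x ∈ H → x' ∈ H → x < x' → y' < y := by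
    intro x y x' y' h h' hx hx' hxx
    exact h.right_lt h' hxx (hlt x' hx' y (hHT x hx y h))
  have hy₀max : ∀ t ∈ T, t ≤ y₀ := by
    intro t ht
    obtain ⟨x, hx, hxt⟩ := hTH t ht
    rcases (hmin x hx).eq_or_lt with rfl | h
    · exact (hxt.right_unique hxy₀).le
    · exact (hnest hxy₀ hxt hx₀ hx h).le
  -- remaining nodes below or equal to a node over `H` are over `H`
  have hmemH : ∀ {a b x y}, IsArc ε a b → .region a b ∉ D → x ∈ H → IsArc ε x y → x ≤ a → b ≤ y →
      a ∈ H := by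
    intro a b x y hab habD hx hxy hxa hby
    have haR : a ∉ removed D := by rwa [hD.left_mem_removed hab]
    rcases hconv a haR x hx y (hHT x hx y hxy) hxa (hab.lt.le.trans hby) with h | h
    · exact h
    · exact absurd ((hT a h).2.symm.trans hab.balls_left) (by simp)
  have hheir : ∀ {x y a b}, x ∈ H → IsArc ε x y → IsHeir ε a b (.region x y) → a ∈ H := by
    intro x y a b hx hxy hh
    have h1 := hh.offspring.inside
    refine hmemH hh.offspring.isArc_left (fun hab => hnotD hx hxy ?_) hx hxy h1.1.le h1.2.le
    exact hD.mem_of_color_eq hab hxy hh.color_eq.symm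
  have hleaf : ∀ {x y}, x ∈ H → IsArc ε x y → IsLeaf ε (.region x y) → x = m := by
    intro x y hx hxy hl
    by_contra hne
    have hxm := lt_of_le_of_ne (hmmax x hx) hne
    obtain ⟨p, q, ho, -⟩ := exists_offspring_around hmm' hxy hxm (hnest hxy hmm' hx hm hxm)
    exact hl.2.2 _ ho
  have hcolor : ∀ N : ℕ, ∀ x y, (y - x).toNat = N → x ∈ H → IsArc ε x y →
      color ε (.region x y) = .region m m' ∧
        (generation ε (.region x y) : ℕ∞) ≤ (H ∩ Set.Ici x).encard := by
    intro N
    induction N using Nat.strong_induction_on with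
    | _ N ih =>
      intro x y hN hx hxy
      rcases hxy.leaf_or_exists_heir with ⟨hl, hg⟩ | ⟨p, q, hh⟩
      · refine ⟨?_, ?_⟩
        · rw [hl.color_eq]
          obtain rfl := hleaf hx hxy hl
          rw [hxy.right_unique hmm']
        · rw [hg, Nat.cast_one, Set.one_le_encard_iff_nonempty]
          exact ⟨x, hx, Set.mem_Ici.2 le_rfl⟩
      · have hpq := hh.offspring.isArc_left
        have h1 := hh.offspring.inside
        have h2 := hpq.lt
        obtain ⟨h3, h4⟩ := ih (q - p).toNat (by omega) p q rfl (hheir hx hxy hh) hpq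
        refine ⟨hh.color_eq.trans h3, ?_⟩
        rw [hh.generation_eq, Nat.cast_add, Nat.cast_one]
        have hsub : insert x (H ∩ Set.Ici p) ⊆ H ∩ Set.Ici x := by
          rintro z (rfl | hz)
          · exact ⟨hx, Set.mem_Ici.2 le_rfl⟩
          · exact ⟨hz.1, h1.1.le.trans hz.2⟩
        have hx' : x ∉ H ∩ Set.Ici p := fun h => absurd h.2 (not_le.2 h1.1)
        calc (generation ε (.region p q) : ℕ∞) + 1 ≤ (H ∩ Set.Ici p).encard + 1 := by gcongr
          _ = (insert x (H ∩ Set.Ici p)).encard := (Set.encard_insert_of_notMem hx').symm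
          _ ≤ _ := Set.encard_le_encard hsub
  have hkD : TreeNode.region m m' ∉ D := hnotD hm hmm'
  have hkleaf : IsLeaf ε (.region m m') := (hcolor _ m m' rfl hm hmm').1 ▸ hmm'.isLeaf_color
  have hgen₀ : (generation ε (.region x₀ y₀) : ℕ∞) ≤ H.encard :=
    (hcolor _ x₀ y₀ rfl hx₀ hxy₀).2.trans (Set.encard_le_encard Set.inter_subset_left)
  -- conversely, a node with the color of the leaf lies over `H`
  have hback : ∀ N : ℕ, ∀ a b, (b - a).toNat = N → IsArc ε a b →
      color ε (.region a b) = .region m m' → a ∈ H := by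
    intro N
    induction N using Nat.strong_induction_on with
    | _ N ih =>
      intro a b hN hab hc
      have habD : TreeNode.region a b ∉ D := by
        intro h
        exact hkD (hD.mem_of_color_eq h hmm' (hc.trans hkleaf.color_eq.symm))
      rcases hab.leaf_or_exists_heir with ⟨hl, -⟩ | ⟨p, q, hh⟩
      · rw [hl.color_eq] at hc
        cases hc
        exact hm
      · have hpq := hh.offspring.isArc_left
        have h1 := hh.offspring.inside
        have h2 := hpq.lt
        have hp := ih (q - p).toNat (by omega) p q rfl hpq (hh.color_eq.symm.trans hc)
        rcases (hmin p hp).eq_or_lt with rfl | h3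
        · obtain rfl := hpq.right_unique hxy₀
          exact absurd hh (hroot _ hx₀ hmin _ hy₀ hy₀max hgen₀ a b habD)
        · have h4 := hh.offspring.le_of_inside hxy₀ h3 (hnest hxy₀ hpq hx₀ hp h3)
          exact hmemH hab habD hx₀ hxy₀ h4.1 h4.2
  have hbranch : ∀ a b, TreeNode.region a b ∈ branch ε (.region m m') ↔ a ∈ H ∧ IsArc ε a b := by
    intro a b
    rw [region_mem_branch_iff]
    exact ⟨fun h => ⟨hback _ a b rfl h.1 h.2, h.1⟩, fun h => ⟨h.2, (hcolor _ a b rfl h.1 h.2).1⟩⟩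
  refine ⟨.region m m', hkleaf, hkD, ?_, ?_, ?_⟩
  · ext x
    constructor
    · intro hx
      obtain ⟨y, hy⟩ := exists_arc_right (hH x hx).2
      exact ⟨y, (hbranch x y).2 ⟨hx, hy⟩⟩
    · rintro ⟨y, hy⟩
      exact ((hbranch x y).1 hy).1
  · ext t
    constructor
    · intro ht
      obtain ⟨x, hx, hxt⟩ := hTH t ht
      exact ⟨x, (hbranch x t).2 ⟨hx, hxt⟩⟩
    · rintro ⟨x, hx⟩
      obtain ⟨h1, h2⟩ := (hbranch x t).1 hx
      exact hHT x h1 t h2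
  · refine ⟨?_, ?_, ?_, ?_⟩
    · rintro (h | h)
      · exact hD.root_notMem h
      · exact root_notMem_branch _ h
    · rintro a b (h | h)
      · exact hD.isArc h
      · exact ((hbranch a b).1 h).2
    · rintro a b c d (h | h) hcd hac hdb
      · exact .inl (hD.mem_of_inside h hcd hac hdb)
      · by_cases hcdD : TreeNode.region c d ∈ D
        · exact .inl hcdD
        · obtain ⟨h1, h2⟩ := (hbranch a b).1 h
          exact .inr ((hbranch c d).2 ⟨hmemH hcd hcdD h1 h2 hac.le hdb.le, hcd⟩)
    · rintro a b c d (h | h) hcd hc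
      · exact .inl (hD.mem_of_color_eq h hcd hc)
      · rw [region_mem_branch_iff] at h
        exact .inr (region_mem_branch_iff.2 ⟨hcd, hc ▸ h.2⟩)

/-! ### Neighbouring runs -/

theorem exists_greatest_remaining (hD : IsStage ε D) (x : ℤ) :
    ∃ z, z ∉ removed D ∧ z < x ∧ ∀ y, y ∉ removed D → y < x → y ≤ z := by
  obtain ⟨z, ⟨h1, h2⟩, h3⟩ := Int.exists_greatest_of_bdd
    (P := fun z => z ∉ removed D ∧ z < x) ⟨x, fun z hz => hz.2.le⟩
    ⟨min 0 (x - 1), fun h => absurd (hD.Icc_of_mem_removed h).1 (by omega), by omega⟩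
  exact ⟨z, h1, h2, fun y hy hyx => h3 y ⟨hy, hyx⟩⟩

theorem exists_least_remaining (hD : IsStage ε D) (x : ℤ) :
    ∃ z, z ∉ removed D ∧ x < z ∧ ∀ y, y ∉ removed D → x < y → z ≤ y := by
  obtain ⟨z, ⟨h1, h2⟩, h3⟩ := Int.exists_least_of_bdd
    (P := fun z => z ∉ removed D ∧ x < z) ⟨x, fun z hz => hz.2.le⟩
    ⟨max (2 * ε.n + 1) (x + 1), fun h => absurd (hD.Icc_of_mem_removed h).2 (by omega), by omega⟩
  exact ⟨z, h1, h2, fun y hy hyx => h3 y ⟨hy, hyx⟩⟩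

/-- The last remaining box before a run has the other content. -/
theorem ne_of_greatest_remaining {η : BallConfiguration} {R : Set ℤ} {x y z : ℤ}
    (hy : y ∈ runOf η R x) (hmin : ∀ w ∈ runOf η R x, y ≤ w) (hzR : z ∉ R) (hzy : z < y)
    (hz : ∀ w, w ∉ R → w < y → w ≤ z) : η z ≠ η y := by
  intro h
  refine absurd (hmin z (mem_runOf_of_adjacent hy hzR h fun w hw hm => ?_)) (not_le.2 hzy)
  rw [Set.uIcc_of_ge hzy.le] at hm
  rcases hm.2.eq_or_lt with rfl | h1
  · exact .inr hy
  · exact .inl ((hz w hw h1).antisymm hm.1)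

/-- The first remaining box after a run has the other content. -/
theorem ne_of_least_remaining {η : BallConfiguration} {R : Set ℤ} {x y z : ℤ}
    (hy : y ∈ runOf η R x) (hmax : ∀ w ∈ runOf η R x, w ≤ y) (hzR : z ∉ R) (hyz : y < z)
    (hz : ∀ w, w ∉ R → y < w → z ≤ w) : η z ≠ η y := by
  intro h
  refine absurd (hmax z (mem_runOf_of_adjacent hy hzR h fun w hw hm => ?_)) (not_le.2 hyz)
  rw [Set.uIcc_of_le hyz.le] at hm
  rcases hm.1.eq_or_lt with rfl | h1
  · exact .inr hy
  · exact .inl (hm.2.antisymm (hz w hw h1))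

/-- Every member of the run of `z` is on the same side of a remaining box `y` of the other content
as `z`. -/
theorem lt_of_mem_runOf {η : BallConfiguration} {R : Set ℤ} {y z w : ℤ} (hw : w ∈ runOf η R z)
    (hy : y ∉ R) (hne : η z ≠ η y) (hzy : z < y) : w < y := by
  by_contra h
  exact hne (hw.2 y hy (Set.Icc_subset_uIcc ⟨hzy.le, not_lt.1 h⟩)).symm

theorem gt_of_mem_runOf {η : BallConfiguration} {R : Set ℤ} {y z w : ℤ} (hw : w ∈ runOf η R z)
    (hy : y ∉ R) (hne : η z ≠ η y) (hyz : y < z) : y < w := by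
  by_contra h
  exact hne (hw.2 y hy (Set.Icc_subset_uIcc' ⟨not_lt.1 h, hyz.le⟩)).symm

/-! ### A step of the algorithm identifies a branch -/

/-- A step of the Head-Tail algorithm identifies the soliton of a branch. -/
theorem IsStage.exists_branch_of_isHTSoliton (hD : IsStage ε D) {γ : Soliton}
    (h : IsHTSoliton ε.balls (removed D) γ) :
    ∃ k, IsLeaf ε k ∧ k ∉ D ∧ γ = branchSoliton (branch ε k) ∧ IsStage ε (D ∪ branch ε k) := by
  obtain ⟨I, ⟨⟨x, hxR, hI⟩, hfin, hmin, hleft⟩, hγ⟩ := h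
  have hxI : x ∈ I := hI ▸ mem_runOf_self hxR
  have hIR : ∀ y ∈ I, y ∉ removed D := fun y hy => by
    rw [hI] at hy
    exact hy.1
  rcases hγ with ⟨hIt, hhead, ⟨hTR, hcard, hlt, hnear⟩, hTf⟩ |
    ⟨hIf, htail, ⟨hHR, hcard, hlt, hnear⟩, hHt⟩
  · obtain ⟨k, hk, hkD, hH, hT, hst⟩ := hD.exists_branch (H := I) (T := γ.tail) hfin ⟨x, hxI⟩ hcard
      (fun y hy => ⟨hIR y hy, hIt y hy⟩) (fun t ht => ⟨hTR ht, hTf t ht⟩)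
      (fun y hy t ht => hlt t ht y hy)
      (by
        intro z hzR y hy t ht hyz hzt
        by_cases hz : ∀ y ∈ I, y < z
        · rcases hzt.eq_or_lt with rfl | hzt
          · exact .inr ht
          · exact .inr (hnear t ht z hzR hz hzt)
        · push Not at hz
          obtain ⟨y', hy', hzy'⟩ := hz
          rw [hI] at hy hy' ⊢
          exact .inl (mem_runOf_of_mem_Icc hy hy' hzR hyz hzy'))
      (by
        intro x₀ hx₀ hx₀min y₀ hy₀ hy₀max hgen c d hvD hh
        obtain ⟨z, hzR, hzx, hz⟩ := exists_greatest_remaining hD x₀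
        have hne : ε.balls z ≠ ε.balls x₀ := by
          rw [hI] at hx₀ hx₀min
          exact ne_of_greatest_remaining hx₀ hx₀min hzR hzx hz
        have hzf : ε.balls z = false := by
          rwa [hIt x₀ hx₀, ne_eq, Bool.not_eq_true] at hne
        have hz' : ∀ y, y ∉ removed D → z < y → x₀ ≤ y := fun y hy hzy => by
          by_contra hyx
          exact absurd (hz y hy (not_le.1 hyx)) (not_le.2 hzy)
        obtain ⟨p, hp⟩ := hD.left_sibling hh.offspring hvD hzR hzx hz' hzf
        have hpz := hp.isArc_left
        have hpR : p ∉ removed D := by rwa [hD.left_mem_removed hpz, ← hD.right_mem_removed hpz]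
        have hJ : (runOf ε.balls (removed D) z).encard ≤ generation ε (.region p z) := by
          refine hD.encard_le_generation_left hpz (fun y hy => ?_) hpR
          exact hz y hy.1 (lt_of_mem_runOf hy (hIR _ hx₀) hne hzx)
        -- the run before `I` is strictly larger than `I`, which is the leftmost smallest run
        have hIJ : I.encard < (runOf ε.balls (removed D) z).encard := by
          refine lt_of_le_of_ne (hmin _ ⟨z, hzR, rfl⟩) fun he => ?_
          have hzJ := mem_runOf_self (η := ε.balls) hzR
          refine absurd (hleft _ ⟨z, hzR, rfl⟩ he.symm (fun hJI => ?_) x₀ hx₀ z hzJ)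
            (not_lt.2 hzx.le)
          rw [hJI] at hzJ
          exact absurd ((hIt z hzJ).symm.trans hzf) (by simp)
        have h1 := (hgen.trans_lt hIJ).trans_le hJ
        exact absurd (hh.le _ _ hp) (not_le.2 (by exact_mod_cast h1)))
    exact ⟨k, hk, hkD, Soliton.ext (hhead.trans hH) hT, hst⟩
  · have hHfin : γ.head.Finite := by
      rw [← Set.encard_lt_top_iff, hcard]
      exact hfin.encard_lt_top
    obtain ⟨k, hk, hkD, hH, hT, hst⟩ := hD.exists_branch (H := γ.head) (T := I) hHfin
      (by
        rw [← Set.one_le_encard_iff_nonempty, hcard, Set.one_le_encard_iff_nonempty]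
        exact ⟨x, hxI⟩)
      hcard.symm
      (fun y hy => ⟨hHR hy, hHt y hy⟩) (fun t ht => ⟨hIR t ht, hIf t ht⟩) hlt
      (by
        intro z hzR y hy t ht hyz hzt
        by_cases hz : ∀ t ∈ I, z < t
        · rcases hyz.eq_or_lt with rfl | hyz
          · exact .inl hy
          · exact .inl (hnear y hy z hzR hz hyz)
        · push Not at hz
          obtain ⟨t', ht', hzt'⟩ := hz
          rw [hI] at ht ht' ⊢
          exact .inr (mem_runOf_of_mem_Icc ht' ht hzR hzt' hzt))
      (by
        intro x₀ hx₀ hx₀min y₀ hy₀ hy₀max hgen c d hvD hh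
        obtain ⟨z, hzR, hyz, hz⟩ := exists_least_remaining hD y₀
        have hne : ε.balls z ≠ ε.balls y₀ := by
          rw [hI] at hy₀ hy₀max
          exact ne_of_least_remaining hy₀ hy₀max hzR hyz hz
        have hzt : ε.balls z = true := by
          rwa [hIf y₀ hy₀, ne_eq, Bool.not_eq_false] at hne
        have hz' : ∀ y, y ∉ removed D → y < z → y ≤ y₀ := fun y hy hyz => by
          by_contra hyx
          exact absurd (hz y hy (not_le.1 hyx)) (not_le.2 hyz)
        obtain ⟨q, hq⟩ := hD.right_sibling hh.offspring hvD hzR hyz hz' hzt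
        have hzq := hq.isArc_left
        have hqR : q ∉ removed D := by rwa [hD.right_mem_removed hzq, ← hD.left_mem_removed hzq]
        have hJ : (runOf ε.balls (removed D) z).encard ≤ generation ε (.region z q) := by
          refine hD.encard_le_generation_right hzq (fun y hy => ?_) hqR
          exact hz y hy.1 (gt_of_mem_runOf hy (hIR _ hy₀) hne hyz)
        have h1 := (hgen.trans (hcard.le.trans (hmin _ ⟨z, hzR, rfl⟩))).trans hJ
        -- in case of a tie the sibling wins because it is further to the right
        have h2 := hh.position_le _ _ hq ((hh.le _ _ hq).antisymm (by exact_mod_cast h1))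
        have h3 := hlt x₀ hx₀ y₀ hy₀
        omega)
    exact ⟨k, hk, hkD, Soliton.ext hH (htail.trans hT), hst⟩

/-! ### The algorithm can be carried out -/

/-- A set of integers with a lower bound and at least `k` elements has `k` smallest elements. -/
theorem exists_initial_of_le_encard {S : Set ℤ} {m : ℤ} (hm : ∀ s ∈ S, m < s) (k : ℕ)
    (hk : (k : ℕ∞) ≤ S.encard) :
    ∃ T ⊆ S, T.encard = k ∧ ∀ t ∈ T, ∀ s ∈ S, s < t → s ∈ T := by
  induction k with
  | zero => exact ⟨∅, by simp, by simp, by simp⟩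
  | succ k ih =>
    obtain ⟨T, hTS, hT, hini⟩ := ih ((by exact_mod_cast k.le_succ : (k : ℕ∞) ≤ (k + 1 : ℕ)).trans hk)
    have hne : ∃ s, s ∈ S ∧ s ∉ T := by
      by_contra! hall
      have h1 := hk.trans (Set.encard_le_encard (show S ⊆ T from hall))
      rw [hT] at h1
      have : k + 1 ≤ k := by exact_mod_cast h1
      omega
    obtain ⟨s, ⟨hsS, hsT⟩, hmin⟩ := Int.exists_least_of_bdd (P := fun s => s ∈ S ∧ s ∉ T)
      ⟨m, fun z hz => (hm z hz.1).le⟩ hne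
    refine ⟨insert s T, Set.insert_subset hsS hTS, ?_, ?_⟩
    · rw [Set.encard_insert_of_notMem hsT, hT, Nat.cast_add, Nat.cast_one]
    · rintro t (rfl | ht) u hu hut
      · by_contra h
        have := hmin u ⟨hu, fun h' => h (.inr h')⟩
        omega
      · exact .inr (hini t ht u hu hut)

/-- A set of integers with an upper bound and at least `k` elements has `k` largest elements. -/
theorem exists_final_of_le_encard {S : Set ℤ} {m : ℤ} (hm : ∀ s ∈ S, s < m) (k : ℕ)
    (hk : (k : ℕ∞) ≤ S.encard) :
    ∃ T ⊆ S, T.encard = k ∧ ∀ t ∈ T, ∀ s ∈ S, t < s → s ∈ T := by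
  obtain ⟨T, hTS, hT, hini⟩ := exists_initial_of_le_encard (S := Neg.neg '' S) (m := -m)
    (by
      rintro _ ⟨s, hs, rfl⟩
      exact neg_lt_neg (hm s hs)) k (by rwa [neg_injective.encard_image])
  refine ⟨Neg.neg '' T, ?_, by rwa [neg_injective.encard_image], ?_⟩
  · rintro _ ⟨t, ht, rfl⟩
    obtain ⟨s, hs, rfl⟩ := hTS ht
    simpa using hs
  · rintro _ ⟨t, ht, rfl⟩ s hs hts
    exact ⟨-s, hini t ht (-s) ⟨s, hs, rfl⟩ (by omega), by simp⟩

theorem IsStage.infinite_runOf (hD : IsStage ε D) {x : ℤ} (hx : x ≤ 0) :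
    (runOf ε.balls (removed D) x).Infinite := by
  have hf : ∀ y : ℤ, y ≤ 0 → ε.balls y = false := fun y hy =>
    balls_eq_false_of_notMem (by omega)
  refine (Set.Iic_infinite (0 : ℤ)).mono fun y hy => ⟨?_, fun z _ hz => ?_⟩
  · intro h
    exact absurd (hD.Icc_of_mem_removed h).1 (not_lt.2 hy)
  · rw [Set.mem_uIcc] at hz
    rw [Set.mem_Iic] at hy
    rw [hf z (by omega), hf x hx]

/-- While there are occupied boxes left, there is a leftmost smallest run. -/
theorem IsStage.exists_isLeftmostSmallestRun (hD : IsStage ε D) {x : ℤ} (hx : x ∉ removed D)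
    (hxt : ε.balls x = true) : ∃ I, IsLeftmostSmallestRun ε.balls (removed D) I := by
  have hxfin : (runOf ε.balls (removed D) x).Finite := by
    refine (Set.finite_Icc 1 (2 * (ε.n : ℤ))).subset fun y hy => ?_
    have h := balls_eq_true_iff.1 ((apply_eq_of_mem_runOf hy).trans hxt)
    exact ⟨h.1, h.2.1⟩
  obtain ⟨x₀, hx₀, hmin⟩ := exists_minimalFor_of_wellFoundedLT (fun y => y ∉ removed D)
    (fun y => (runOf ε.balls (removed D) y).encard) ⟨x, hx⟩
  replace hmin : ∀ y, y ∉ removed D → (runOf ε.balls (removed D) x₀).encard ≤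
      (runOf ε.balls (removed D) y).encard := fun y hy => by
    by_contra h
    exact h (hmin hy (not_le.1 h).le)
  have hfin : ∀ y, (runOf ε.balls (removed D) y).encard = (runOf ε.balls (removed D) x₀).encard →
      (runOf ε.balls (removed D) y).Finite := by
    intro y hy
    rw [← Set.encard_lt_top_iff, hy]
    exact (hmin x hx).trans_lt hxfin.encard_lt_top
  obtain ⟨x₁, ⟨hx₁, hcard⟩, hleast⟩ := Int.exists_least_of_bdd
    (P := fun y => y ∉ removed D ∧ (runOf ε.balls (removed D) y).encard =
      (runOf ε.balls (removed D) x₀).encard)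
    ⟨0, fun z hz => by
      by_contra h
      exact hD.infinite_runOf (not_le.1 h).le (hfin z hz.2)⟩ ⟨x₀, hx₀, rfl⟩
  refine ⟨_, ⟨x₁, hx₁, rfl⟩, hfin _ hcard, ?_, ?_⟩
  · rintro _ ⟨y, hy, rfl⟩
    rw [hcard]
    exact hmin y hy
  · rintro _ ⟨y, hy, rfl⟩ he hne u hu w hw
    have hwcard : (runOf ε.balls (removed D) w) = runOf ε.balls (removed D) y := runOf_eq hw
    have hle := hleast w ⟨hw.1, by rw [hwcard, he, hcard]⟩
    by_contra hwu
    have h1 := mem_runOf_of_mem_Icc (mem_runOf_self hx₁) hu hw.1 hle (not_lt.1 hwu)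
    exact hne (hwcard.symm.trans (runOf_eq h1))

/-- While there are occupied boxes left, the algorithm can make a step. -/
theorem IsStage.exists_isHTSoliton (hD : IsStage ε D) {x : ℤ} (hx : x ∉ removed D)
    (hxt : ε.balls x = true) : ∃ γ, IsHTSoliton ε.balls (removed D) γ := by
  obtain ⟨I, hI⟩ := hD.exists_isLeftmostSmallestRun hx hxt
  have hI' := hI
  obtain ⟨⟨x₀, hx₀, rfl⟩, hfin, hmin, -⟩ := hI'
  set I := runOf ε.balls (removed D) x₀
  have hne : I.Nonempty := ⟨x₀, mem_runOf_self hx₀⟩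
  have hcard : (I.ncard : ℕ∞) = I.encard := hfin.cast_ncard_eq
  cases hc : ε.balls x₀ with
  | true =>
    have hIt : ∀ y ∈ I, ε.balls y = true := fun y hy => (apply_eq_of_mem_runOf hy).trans hc
    obtain ⟨m, hm, hmax⟩ := Set.exists_max_image I id hfin hne
    obtain ⟨z, hzR, hmz, hz⟩ := exists_least_remaining hD m
    have hzm := ne_of_least_remaining hm hmax hzR hmz hz
    have hzf : ε.balls z = false := by rwa [hIt m hm, ne_eq, Bool.not_eq_true] at hzm
    obtain ⟨T, hTJ, hT, hini⟩ := exists_initial_of_le_encard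
      (fun s hs => gt_of_mem_runOf hs hm.1 hzm hmz) I.ncard
      (hcard ▸ hmin _ ⟨z, hzR, rfl⟩)
    refine ⟨⟨I, T⟩, I, hI, .inl ⟨hIt, rfl, ⟨fun t ht => (hTJ ht).1, hT.trans hcard,
      fun t ht y hy => ?_, fun t ht w hw hIw hwt => ?_⟩, fun t ht => ?_⟩⟩
    · exact (hmax y hy).trans_lt (gt_of_mem_runOf (hTJ ht) hm.1 hzm hmz)
    · exact hini t ht w (mem_runOf_of_mem_Icc (mem_runOf_self hzR) (hTJ ht) hw
        (hz w hw (hIw m hm)) hwt.le) hwt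
    · exact (apply_eq_of_mem_runOf (hTJ ht)).trans hzf
  | false =>
    have hIf : ∀ y ∈ I, ε.balls y = false := fun y hy => (apply_eq_of_mem_runOf hy).trans hc
    obtain ⟨m, hm, hmin'⟩ := Set.exists_min_image I id hfin hne
    obtain ⟨z, hzR, hzm, hz⟩ := exists_greatest_remaining hD m
    have hne := ne_of_greatest_remaining hm hmin' hzR hzm hz
    have hzt : ε.balls z = true := by rwa [hIf m hm, ne_eq, Bool.not_eq_false] at hne
    obtain ⟨T, hTJ, hT, hini⟩ := exists_final_of_le_encard
      (fun s hs => lt_of_mem_runOf hs hm.1 hne hzm) I.ncard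
      (hcard ▸ hmin _ ⟨z, hzR, rfl⟩)
    refine ⟨⟨T, I⟩, I, hI, .inr ⟨hIf, rfl, ⟨fun t ht => (hTJ ht).1, hT.trans hcard,
      fun t ht y hy => ?_, fun t ht w hw hIw hwt => ?_⟩, fun t ht => ?_⟩⟩
    · exact (lt_of_mem_runOf (hTJ ht) hm.1 hne hzm).trans_le (hmin' y hy)
    · exact hini t ht w (mem_runOf_of_mem_Icc (hTJ ht) (mem_runOf_self hzR) hw hwt.le
        (hz w hw (hIw m hm))) hwt
    · exact (apply_eq_of_mem_runOf (hTJ ht)).trans hzt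

theorem IsStage.singleInfiniteRun_iff (hD : IsStage ε D) :
    SingleInfiniteRun ε.balls (removed D) ↔ ∀ x, ε.balls x = true → x ∈ removed D := by
  have h0 : (0 : ℤ) ∉ removed D := fun h => absurd (hD.Icc_of_mem_removed h).1 (lt_irrefl _)
  have h0f : ε.balls 0 = false := balls_eq_false_of_notMem (by omega)
  constructor
  · rintro ⟨⟨x, hx, he⟩, -⟩ y hyt
    by_contra hy
    have h1 := apply_eq_of_mem_runOf (he ▸ (show y ∈ (removed D)ᶜ from hy))
    have h2 := apply_eq_of_mem_runOf (he ▸ (show (0 : ℤ) ∈ (removed D)ᶜ from h0))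
    rw [hyt] at h1
    rw [h0f, ← h1] at h2
    exact absurd h2 (by simp)
  · intro h
    have hf : ∀ y, y ∉ removed D → ε.balls y = false := by
      intro y hy
      rw [← Bool.not_eq_true]
      exact fun h' => hy (h y h')
    refine ⟨⟨0, h0, ?_⟩, (hD.infinite_runOf le_rfl).mono fun y hy => hy.1⟩
    ext y
    exact ⟨fun hy => ⟨hy, fun z hz _ => by rw [hf z hz, h0f]⟩, fun hy => hy.1⟩

/-! ### The outcome of the algorithm -/

theorem isStage_empty : IsStage ε ∅ :=
  ⟨fun h => h, fun h => absurd h (by simp), fun h => absurd h (by simp),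
    fun h => absurd h (by simp)⟩

theorem removed_empty : removed ∅ = ∅ := by
  simp [removed, Soliton.boxes, branchSoliton]

theorem removed_union (B : Set TreeNode) :
    removed (D ∪ B) = removed D ∪ (branchSoliton B).boxes := by
  ext x
  simp only [removed, Soliton.boxes, branchSoliton, Set.mem_union, Set.mem_ofPred_eq, exists_or]
  tauto

/-- The solitons of the branches outside of `D`. -/
def remainingSolitons (ε : SoftExcursion) (D : Set TreeNode) : Set Soliton :=
  {γ | ∃ k, IsLeaf ε k ∧ k ∉ D ∧ γ = branchSoliton (branch ε k)}

theorem remainingSolitons_eq_insert {k : TreeNode} (hk : IsLeaf ε k) (hkD : k ∉ D) :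
    remainingSolitons ε D =
      insert (branchSoliton (branch ε k)) (remainingSolitons ε (D ∪ branch ε k)) := by
  ext γ
  constructor
  · rintro ⟨l, hl, hlD, rfl⟩
    by_cases hlk : l = k
    · exact .inl (by rw [hlk])
    · refine .inr ⟨l, hl, ?_, rfl⟩
      rintro (h | ⟨g, h⟩)
      · exact hlD h
      · exact hlk (hl.color_eq.symm.trans h.color_eq)
  · rintro (rfl | ⟨l, hl, hlD, rfl⟩)
    · exact ⟨k, hk, hkD, rfl⟩
    · exact ⟨l, hl, fun h => hlD (.inl h), rfl⟩

theorem IsStage.remainingSolitons_eq_empty (hD : IsStage ε D)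
    (h : SingleInfiniteRun ε.balls (removed D)) : remainingSolitons ε D = ∅ := by
  refine Set.eq_empty_of_forall_notMem ?_
  rintro γ ⟨k, hk, hkD, -⟩
  cases k with
  | root => exact hk.2.1 rfl
  | region a b =>
    have hab : IsArc ε a b := hk.1
    exact hkD ((hD.left_mem_removed hab).1 (hD.singleInfiniteRun_iff.1 h a hab.balls_left))

theorem IsStage.eq_remainingSolitons (hD : IsStage ε D) {Γ : Set Soliton}
    (h : HTAlgorithm ε.balls (removed D) Γ) : Γ = remainingSolitons ε D := by
  generalize hR : removed D = R at h
  induction h generalizing D with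
  | done R hs =>
    subst hR
    exact (hD.remainingSolitons_eq_empty hs).symm
  | step R γ Γ _ hγ _ ih =>
    subst hR
    obtain ⟨k, hk, hkD, rfl, hst⟩ := hD.exists_branch_of_isHTSoliton hγ
    rw [remainingSolitons_eq_insert hk hkD, ih hst (removed_union _)]

theorem IsStage.htAlgorithm (hD : IsStage ε D) :
    HTAlgorithm ε.balls (removed D) (remainingSolitons ε D) := by
  induction hN : (Set.Icc 1 (2 * (ε.n : ℤ)) \ removed D).ncard using Nat.strong_induction_on
    generalizing D with
  | _ N ih =>
    by_cases hs : SingleInfiniteRun ε.balls (removed D)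
    · rw [hD.remainingSolitons_eq_empty hs]
      exact .done _ hs
    · have hs' := hs
      rw [hD.singleInfiniteRun_iff] at hs'
      push Not at hs'
      obtain ⟨x, hxt, hx⟩ := hs'
      obtain ⟨γ, hγ⟩ := hD.exists_isHTSoliton hx hxt
      obtain ⟨k, hk, hkD, rfl, hst⟩ := hD.exists_branch_of_isHTSoliton hγ
      rw [remainingSolitons_eq_insert hk hkD]
      refine .step _ _ _ hs hγ ?_
      rw [← removed_union]
      refine ih _ ?_ hst rfl
      rw [← hN]
      refine Set.ncard_lt_ncard ⟨?_, fun hsub => ?_⟩ (Set.finite_Icc _ _).sdiff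
      · refine Set.sdiff_subset_sdiff_right ?_
        rw [removed_union]
        exact Set.subset_union_left
      · cases k with
        | root => exact hk.2.1 rfl
        | region a b =>
          have hab : IsArc ε a b := hk.1
          have h1 := balls_eq_true_iff.1 hab.balls_left
          refine (hsub ⟨⟨h1.1, h1.2.1⟩, ?_⟩).2 ?_
          · rwa [hD.left_mem_removed hab]
          · rw [hst.left_mem_removed hab]
            exact .inr ⟨1, .leaf _ hk⟩

theorem remainingSolitons_empty : remainingSolitons ε ∅ = treeDecomposition ε := by
  simp [remainingSolitons, treeDecomposition]

end BoxBall

/-- For every excursion, the Head-Tail algorithm terminates, and its (unique) outcome is the soliton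
decomposition induced by the branch decomposition of the planar tree of the excursion. -/
theorem proposition4p1 (ε : BoxBall.SoftExcursion) (Γ : Set BoxBall.Soliton) :
    BoxBall.IsHTDecomposition ε Γ ↔ Γ = BoxBall.treeDecomposition ε := by
  rw [BoxBall.IsHTDecomposition, ← BoxBall.remainingSolitons_empty, ← BoxBall.removed_empty]
  refine ⟨BoxBall.isStage_empty.eq_remainingSolitons, ?_⟩
  rintro rfl
  exact BoxBall.isStage_empty.htAlgorithm
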